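/- For an open set $\Omega\subset\mathbb C^2$ let $A^2(\Omega)$ be the space of holomorphic functions $f$ on $\Omega$ with $\int_\Omega |f|^2\,dV<\infty$, where $dV$ is Lebesgue measure. The Bergman kernel of $\Omega$ is the unique function $\mathbb B_\Omega:\Omega\times\Omega\to\mathbb C$ such that, for every $z\in\Omega$, the function $w\mapsto\overline{\mathbb B_\Omega(z,w)}$ belongs to $A^2(\Omega)$ and $$f(z)=\int_\Omega \mathbb B_\Omega(z,w)\,f(w)\,dV(w)\qquad\text{for all } f\in A^2(\Omega).$$ **Theorem 1.1.** Let $k$ be a positive integer and let $\mathbb H_k=\{(z_1,z_2)\in\mathbb C^2:\ |z_1|^k<|z_2|<1\}$ be the fat Hartogs triangle of exponent $k$. For $z,w\in\mathbb H_k$ put $s=z_1\bar w_1$ and $t=z_2\bar w_2$. Then the Bergman kernel $\mathbb B_k$ of $\mathbb H_k$ is given, for all $z,w\in\mathbb H_k$, by $$\mathbb B_k(z,w)=\frac{p_k(s)\,t^2+q_k(s)\,t+s^k p_k(s)}{k\,\pi^2\,(1-t)^2\,(t-s^k)^2},$$ where $$p_k(s)=\sum_{l=1}^{k-1} l(k-l)\,s^{l-1},\qquad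 q_k(s)=\sum_{l=1}^{k}\bigl(l^2+(k-l)^2 s^k\bigr)\,s^{l-1}.$$ -/

import Mathlib

open MeasureTheory

/-- The Bergman space `A²(Ω)`: functions that are holomorphic on `Ω` and square-integrable on `Ω`
for Lebesgue measure. Only the values on `Ω` matter. -/
def BergmanSpace {E : Type*} [NormedAddCommGroup E] [NormedSpace ℂ E] [MeasureSpace E]
    (Ω : Set E) : Set (E → ℂ) :=
  {f | DifferentiableOn ℂ f Ω ∧ MemLp f 2 (volume.restrict Ω)}

/-- `B` is (on `Ω × Ω`) the Bergman kernel of `Ω`: for each `z ∈ Ω`, the function `conj (B z ·)` is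
the element of `A²(Ω)` that represents the evaluation functional `f ↦ f z` for the inner product
`⟨f, g⟩ = ∫_Ω f * conj g`. -/
def IsBergmanKernel {E : Type*} [NormedAddCommGroup E] [NormedSpace ℂ E] [MeasureSpace E]
    (Ω : Set E) (B : E → E → ℂ) : Prop :=
  ∀ z ∈ Ω, (fun w => starRingEnd ℂ (B z w)) ∈ BergmanSpace Ω ∧
    ∀ f ∈ BergmanSpace Ω, f z = ∫ w in Ω, B z w * f w

/-- The generalized Hartogs triangle `{(z₁, z₂) ∈ ℂ² : |z₁|^γ < |z₂| < 1}`. -/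
def hartogsTriangle (γ : ℝ) : Set (ℂ × ℂ) :=
  {z | ‖z.1‖ ^ γ < ‖z.2‖ ∧ ‖z.2‖ < 1}

/-- `p_k(s) = ∑_{l=1}^{k-1} l (k - l) s^(l-1)`. -/
noncomputable def hartogsP (k : ℕ) (s : ℂ) : ℂ :=
  ∑ l ∈ Finset.Icc 1 (k - 1), (l : ℂ) * ((k : ℂ) - (l : ℂ)) * s ^ (l - 1)

/-- `q_k(s) = ∑_{l=1}^{k} (l² + (k - l)² s^k) s^(l-1)`. -/
noncomputable def hartogsQ (k : ℕ) (s : ℂ) : ℂ :=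
  ∑ l ∈ Finset.Icc 1 k, ((l : ℂ) ^ 2 + ((k : ℂ) - (l : ℂ)) ^ 2 * s ^ k) * s ^ (l - 1)

/-- The closed form, as a function of `s = z₁ * conj w₁` and `t = z₂ * conj w₂`. -/
noncomputable def hartogsFormula (k : ℕ) (s t : ℂ) : ℂ :=
  (hartogsP k s * t ^ 2 + hartogsQ k s * t + s ^ k * hartogsP k s) /
    ((k : ℂ) * (Real.pi : ℂ) ^ 2 * (1 - t) ^ 2 * (t - s ^ k) ^ 2)

/-!
The map `Φ (u, v) = (u v, v ^ k)` is an unbranched covering of degree `k` from the product `D × D*`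
of the unit disc and the punctured unit disc onto the Hartogs triangle. Its complex Jacobian is
`k v ^ k` and its deck transformations are `(u, v) ↦ (c⁻¹ u, c v)` with `c ^ k = 1`. The kernel of
the triangle is therefore obtained from that of `D × D*` by summing over the deck group, as in
Bell's transformation formula.

* On the disc, the kernel `1 / (π (1 - z * conj w) ^ 2)` reproduces every integrable holomorphic
  function (`disc_reproducing`): on the circle `|w| = r` one has `conj w = r ^ 2 / w`, so Cauchy's
  formula for a derivative evaluates the angular integral, and the radial integral is that of a
  derivative. A square-integrable holomorphic function extends across the puncture
  (`exists_differentiableOn_extension_of_memLp`), and Fubini gives the reproducing formula on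
  `D × D*` (`bidisc_reproducing`).
* `D × D*` is the disjoint union of `k` sheets `v = c (v ^ k) ^ (1 / k)`, with `(v ^ k) ^ (1 / k)`
  the principal root, and `Φ` maps each of them bijectively onto the triangle. This gives the
  change of variables `map_hartogsCover`.
* The sum over the deck group is evaluated (`sum_deck_eq`) by writing each factor `(1 - x) ^ (-2)`
  as a polynomial of degree less than `k` in `x`, with coefficients depending on `x ^ k`, divided by
  `(1 - x ^ k) ^ 2`, and by the orthogonality of the `k`-th roots of unity. The result is the closed
  form (`hartogsFormula_eq_sum_deck`).

Uniqueness is the usual argument: the difference of two kernels is orthogonal to the Bergman space,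
to which its conjugate belongs.
-/

open Metric Set Filter Topology ComplexConjugate

/-! ### The reproducing formula on the disc -/

/-- Integrability in polar coordinates, needed to apply Fubini to
`Complex.integral_comp_polarCoord_symm`. -/
theorem integrableOn_polarCoord_of_integrable {h : ℂ → ℂ} (hh : Integrable h) :
    IntegrableOn (fun p : ℝ × ℝ => p.1 • h (Complex.polarCoord.symm p)) polarCoord.target := by
  have h1 : Integrable (fun p : ℝ × ℝ => h (Complex.measurableEquivRealProd.symm p)) :=
    (Complex.volume_preserving_equiv_real_prod.symm).integrable_comp_of_integrable hh
  have h2 : IntegrableOn (fun p : ℝ × ℝ => h (Complex.measurableEquivRealProd.symm p))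
      (polarCoord.symm '' polarCoord.target) := h1.integrableOn
  rw [integrableOn_image_iff_integrableOn_abs_det_fderiv_smul volume
    polarCoord.open_target.measurableSet
    (fun p _ => (hasFDerivAt_polarCoord_symm p).hasFDerivWithinAt) polarCoord.symm.injOn] at h2
  refine h2.congr_fun (fun p hp => ?_) polarCoord.open_target.measurableSet
  have hp1 : 0 < p.1 := hp.1
  simp only [det_fderivPolarCoordSymm, abs_of_pos hp1,
    Complex.measurableEquivRealProd_symm_polarCoord_symm_apply]

/-- The angular part of the disc formula. On the circle of radius `r`, `conj w = r ^ 2 / w`, so the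
integral is the Cauchy integral for the derivative of `w * g w` at `z * r ^ 2`. -/
theorem circle_reproducing {g : ℂ → ℂ} (hg : DifferentiableOn ℂ g (ball 0 1)) {z : ℂ}
    (hz : ‖z‖ < 1) {r : ℝ} (hr : r ∈ Ioo (0 : ℝ) 1) :
    ∫ θ in Ioo (-Real.pi) Real.pi, g (circleMap 0 r θ) / (1 - z * conj (circleMap 0 r θ)) ^ 2 =
      2 * Real.pi * (g (z * r ^ 2) + z * r ^ 2 * deriv g (z * r ^ 2)) := by
  have hw0 : z * r ^ 2 ∈ ball (0 : ℂ) r := by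
    simp only [mem_ball_zero_iff, norm_mul, norm_pow, Complex.norm_real, Real.norm_eq_abs,
      abs_of_pos hr.1]
    nlinarith [hr.1, hr.2, norm_nonneg z, mul_pos hr.1 hr.1]
  have hsub : closedBall (0 : ℂ) r ⊆ ball 0 1 := closedBall_subset_ball hr.2
  have hC := Complex.two_pi_I_inv_smul_circleIntegral_sub_sq_inv_smul_of_differentiable
    isOpen_ball hsub (f := fun w => w * g w) (differentiableOn_id.mul hg) hw0
  have hgd : DifferentiableAt ℂ g (z * r ^ 2) :=
    hg.differentiableAt (isOpen_ball.mem_nhds (hsub (ball_subset_closedBall hw0)))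
  have hd : deriv (fun w => w * g w) (z * r ^ 2) =
      g (z * r ^ 2) + z * r ^ 2 * deriv g (z * r ^ 2) := by
    rw [deriv_fun_mul differentiableAt_fun_id hgd]; simp
  rw [hd] at hC
  rw [← hC, ← integral_Ioc_eq_integral_Ioo,
    ← intervalIntegral.integral_of_le (by linarith [Real.pi_pos])]
  have hper : Function.Periodic
      (fun θ => g (circleMap 0 r θ) / (1 - z * conj (circleMap 0 r θ)) ^ 2) (2 * Real.pi) := by
    intro θ; simp only [periodic_circleMap 0 r θ]
  have := hper.intervalIntegral_add_eq (-Real.pi) 0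
  rw [show -Real.pi + 2 * Real.pi = Real.pi by ring, zero_add] at this
  rw [this, circleIntegral, smul_eq_mul, ← mul_assoc, ← intervalIntegral.integral_const_mul]
  refine intervalIntegral.integral_congr fun θ _ => ?_
  have hne : circleMap 0 r θ ≠ 0 := by simpa using hr.1.ne'
  have hcc : circleMap 0 r θ * conj (circleMap 0 r θ) = r ^ 2 := by
    rw [Complex.mul_conj, Complex.normSq_eq_norm_sq]; simp
  have hsubne : circleMap 0 r θ - z * r ^ 2 ≠ 0 := by
    intro h0
    rw [sub_eq_zero] at h0
    rw [← h0] at hw0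
    simp [abs_of_pos hr.1] at hw0
  have h1 : circleMap 0 r θ - z * r ^ 2 =
      circleMap 0 r θ * (1 - z * conj (circleMap 0 r θ)) := by
    rw [← hcc]; ring
  have h2 : 1 - z * conj (circleMap 0 r θ) ≠ 0 := by
    intro h0; rw [h1, h0, mul_zero] at hsubne; exact hsubne rfl
  have hpi : (Real.pi : ℂ) ≠ 0 := by exact_mod_cast Real.pi_ne_zero
  simp only [deriv_circleMap, smul_eq_mul]
  rw [h1]
  field_simp

theorem one_sub_mul_conj_ne_zero {z w : ℂ} (hz : ‖z‖ < 1) (hw : ‖w‖ < 1) :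
    1 - z * conj w ≠ 0 := by
  intro h
  have : ‖z * conj w‖ = 1 := by rw [← sub_eq_zero.1 h]; simp
  rw [norm_mul, RCLike.norm_conj] at this
  nlinarith [norm_nonneg z, norm_nonneg w]

theorem norm_inv_one_sub_sq_le {z w : ℂ} (hz : ‖z‖ < 1) (hw : ‖w‖ < 1) :
    ‖((1 - z * conj w) ^ 2)⁻¹‖ ≤ ((1 - ‖z‖) ^ 2)⁻¹ := by
  have h1 : 1 - ‖z‖ ≤ ‖1 - z * conj w‖ := by
    have := norm_sub_norm_le 1 (z * conj w)
    rw [norm_mul, RCLike.norm_conj, norm_one] at this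
    nlinarith [norm_nonneg z, norm_nonneg w]
  rw [norm_inv, norm_pow]
  have : 0 < 1 - ‖z‖ := by linarith
  gcongr

theorem integrableOn_div_one_sub_sq {g : ℂ → ℂ} {s : Set ℂ} (hs : MeasurableSet s)
    (hs1 : s ⊆ ball 0 1) (hi : IntegrableOn g s) {z : ℂ} (hz : ‖z‖ < 1) :
    IntegrableOn (fun w => g w / (1 - z * conj w) ^ 2) s := by
  simp only [div_eq_mul_inv]
  refine Integrable.mul_bdd (c := ((1 - ‖z‖) ^ 2)⁻¹) hi ?_ ?_
  · refine Measurable.aestronglyMeasurable ?_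
    have : Measurable (fun w : ℂ => conj w) := Complex.continuous_conj.measurable
    fun_prop
  · exact ae_restrict_of_forall_mem hs fun w hw =>
      norm_inv_one_sub_sq_le hz (by simpa using hs1 hw)

/-- The reproducing formula of the unit disc, for integrable rather than only square-integrable
holomorphic functions. -/
theorem disc_reproducing {g : ℂ → ℂ} (hg : DifferentiableOn ℂ g (ball 0 1))
    (hi : IntegrableOn g (ball 0 1)) {z : ℂ} (hz : ‖z‖ < 1) :
    ∫ w in ball 0 1, g w / (1 - z * conj w) ^ 2 = Real.pi * g z := by
  have hi' := integrableOn_div_one_sub_sq measurableSet_ball subset_rfl hi hz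
  set h : ℂ → ℂ := (ball 0 1).indicator fun w => g w / (1 - z * conj w) ^ 2 with hh
  have hI : Integrable h := (integrable_indicator_iff measurableSet_ball).2 hi'
  have hI2 := integrableOn_polarCoord_of_integrable hI
  rw [← integral_indicator measurableSet_ball, ← hh, ← Complex.integral_comp_polarCoord_symm]
  rw [polarCoord_target] at hI2 ⊢
  rw [Measure.volume_eq_prod] at hI2 ⊢
  rw [setIntegral_prod _ hI2]
  have hsymm : ∀ r θ : ℝ, Complex.polarCoord.symm (r, θ) = circleMap 0 r θ := by
    intro r θ
    rw [Complex.polarCoord_symm_apply, circleMap_zero, Complex.exp_mul_I]; simp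
  have hstep : ∀ r ∈ Ioi (0 : ℝ), (∫ θ in Ioo (-Real.pi) Real.pi,
      r • h (Complex.polarCoord.symm (r, θ))) = (Ioo (0 : ℝ) 1).indicator (fun r : ℝ =>
        2 * Real.pi * r * (g (z * r ^ 2) + z * r ^ 2 * deriv g (z * r ^ 2))) r := by
    intro r hr
    simp only [hsymm]
    by_cases hr1 : r < 1
    · rw [indicator_of_mem (show r ∈ Ioo (0 : ℝ) 1 from ⟨hr, hr1⟩), integral_smul]
      have : ∀ θ, h (circleMap 0 r θ) =
          g (circleMap 0 r θ) / (1 - z * conj (circleMap 0 r θ)) ^ 2 := by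
        intro θ
        rw [hh, indicator_of_mem]
        simpa [abs_of_pos (mem_Ioi.1 hr)] using hr1
      simp only [this]
      rw [circle_reproducing hg hz ⟨hr, hr1⟩, Complex.real_smul]
      ring
    · rw [indicator_of_notMem (fun hm => hr1 hm.2)]
      have : ∀ θ, h (circleMap 0 r θ) = 0 := by
        intro θ
        rw [hh, indicator_of_notMem]
        simpa [abs_of_pos (mem_Ioi.1 hr)] using hr1
      simp [this]
  rw [setIntegral_congr_fun measurableSet_Ioi hstep, setIntegral_indicator measurableSet_Ioo,
    inter_eq_self_of_subset_right Ioo_subset_Ioi_self, ← integral_Ioc_eq_integral_Ioo,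
    ← intervalIntegral.integral_of_le zero_le_one]
  have hmem : ∀ r ∈ uIcc (0 : ℝ) 1, z * (r : ℂ) ^ 2 ∈ ball (0 : ℂ) 1 := by
    intro r hr
    rw [uIcc_of_le zero_le_one] at hr
    simp only [mem_ball_zero_iff, norm_mul, norm_pow, Complex.norm_real, Real.norm_eq_abs,
      abs_of_nonneg hr.1]
    have : r ^ 2 ≤ 1 := pow_le_one₀ hr.1 hr.2
    nlinarith [norm_nonneg z]
  -- The radial integrand is the derivative of `π r ^ 2 g (z r ^ 2)`.
  have hder : ∀ r ∈ uIcc (0 : ℝ) 1, HasDerivAt (fun r : ℝ => Real.pi * (r : ℂ) ^ 2 *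
      g (z * r ^ 2)) (2 * Real.pi * r * (g (z * r ^ 2) + z * r ^ 2 * deriv g (z * r ^ 2))) r := by
    intro r hr
    have hgd := (hg.differentiableAt (isOpen_ball.mem_nhds (hmem r hr))).hasDerivAt
    have h1 : HasDerivAt (fun x : ℂ => z * x ^ 2) (z * (2 * (r : ℂ))) (r : ℂ) := by
      simpa using (hasDerivAt_pow 2 (r : ℂ)).const_mul z
    have h2 := HasDerivAt.comp (r : ℂ) hgd h1
    have h3 : HasDerivAt (fun x : ℂ => Real.pi * x ^ 2) (Real.pi * (2 * (r : ℂ))) (r : ℂ) := by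
      simpa using (hasDerivAt_pow 2 (r : ℂ)).const_mul (Real.pi : ℂ)
    have h4 := (h3.mul h2).comp_ofReal
    refine h4.congr_deriv ?_
    simp only [Function.comp]
    ring
  rw [intervalIntegral.integral_eq_sub_of_hasDerivAt hder]
  · simp
  · refine ContinuousOn.intervalIntegrable ?_
    have hc : ContinuousOn (fun r : ℝ => z * (r : ℂ) ^ 2) (uIcc 0 1) := by fun_prop
    have hgc := hg.continuousOn.comp hc hmem
    have hgc' := (hg.deriv isOpen_ball).continuousOn.comp hc hmem
    simp only [Function.comp_def] at hgc hgc'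
    exact (continuousOn_const.mul Complex.continuous_ofReal.continuousOn).mul
      (hgc.add (hc.mul hgc'))

/-! ### Removable singularities and the bidisc -/

/-- The area mean value property, which is the disc formula at the centre. -/
theorem integral_ball_eq_of_differentiableOn {h : ℂ → ℂ} {c : ℂ} {R : ℝ} (hR : 0 < R)
    (hd : DifferentiableOn ℂ h (ball c R)) (hi : IntegrableOn h (ball c R)) :
    ∫ w in ball c R, h w = Real.pi * R ^ 2 * h c := by
  have hmem : ∀ x : ℂ, c + R • x ∈ ball c R ↔ x ∈ ball (0 : ℂ) 1 := by
    intro x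
    rw [mem_ball, dist_self_add_left, mem_ball_zero_iff, norm_smul, Real.norm_eq_abs,
      abs_of_pos hR]
    exact mul_lt_iff_lt_one_right hR
  set H : ℂ → ℂ := (ball c R).indicator h with hH
  have hI : Integrable H := (integrable_indicator_iff measurableSet_ball).2 hi
  have hind : (fun x : ℂ => H (c + R • x)) =
      (ball (0 : ℂ) 1).indicator (fun x => h (c + R • x)) := by
    ext x
    by_cases hx : x ∈ ball (0 : ℂ) 1
    · rw [indicator_of_mem hx, hH, indicator_of_mem ((hmem x).2 hx)]
    · rw [indicator_of_notMem hx, hH, indicator_of_notMem (fun h' => hx ((hmem x).1 h'))]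
  have hI' : Integrable (fun x : ℂ => H (c + R • x)) :=
    (hI.comp_add_left c).comp_smul hR.ne'
  have hI'' : IntegrableOn (fun x => h (c + R • x)) (ball (0 : ℂ) 1) := by
    rwa [hind, integrable_indicator_iff measurableSet_ball] at hI'
  have hdc : DifferentiableOn ℂ (fun x => h (c + R • x)) (ball (0 : ℂ) 1) :=
    hd.comp (by fun_prop) fun x hx => (hmem x).2 hx
  have key := disc_reproducing hdc hI'' (z := 0) (by simp)
  simp only [zero_mul, sub_zero, one_pow, div_one, smul_zero, add_zero] at key
  have h1 : ∫ x : ℂ, H (c + R • x) = ((R : ℂ) ^ 2)⁻¹ * ∫ x in ball c R, h x := by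
    rw [Measure.integral_comp_smul_of_nonneg volume (fun x => H (c + x)) R (hR := hR.le),
      integral_add_left_eq_self H c, Complex.finrank_real_complex, hH,
      integral_indicator measurableSet_ball, Complex.real_smul]
    push_cast
    rfl
  rw [hind, integral_indicator measurableSet_ball, key] at h1
  have : (R : ℂ) ≠ 0 := by exact_mod_cast hR.ne'
  field_simp at h1
  rw [← h1]; ring

/-- A square-integrable holomorphic function on the punctured disc has a removable singularity: by
the mean value property of `g ^ 2`, `‖w * g w‖ ^ 2` is at most a constant times the integral of
`‖g‖ ^ 2` over a disc that shrinks to the origin, hence `g w = o(1 / w)`. -/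
theorem exists_differentiableOn_extension_of_memLp {g : ℂ → ℂ}
    (hg : DifferentiableOn ℂ g (ball 0 1 \ {0}))
    (hL : MemLp g 2 (volume.restrict (ball 0 1 \ {0}))) :
    ∃ G : ℂ → ℂ, DifferentiableOn ℂ G (ball 0 1) ∧ EqOn G g (ball 0 1 \ {0}) := by
  refine ⟨Function.update g 0 (limUnder (𝓝[≠] 0) g),
    Complex.differentiableOn_update_limUnder_of_isLittleO (ball_mem_nhds _ one_pos) hg ?_,
    fun z hz => Function.update_of_ne hz.2 _ _⟩
  have hsq : IntegrableOn (fun w => ‖g w‖ ^ 2) (ball 0 1 \ {0}) :=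
    (memLp_two_iff_integrable_sq_norm hL.1).1 hL
  -- The mean value property of `g ^ 2` on the disc of radius `‖w‖ / 2` about `w`.
  have hbound : ∀ w : ℂ, w ≠ 0 → ‖w‖ < 1 / 2 → ‖w * g w‖ ^ 2 ≤
      4 / Real.pi * ∫ x in ball w (‖w‖ / 2), ‖g x‖ ^ 2 ∂(volume.restrict (ball 0 1 \ {0})) := by
    intro w hw0 hw
    have hpos : 0 < ‖w‖ := norm_pos_iff.2 hw0
    have hsub : ball w (‖w‖ / 2) ⊆ ball 0 1 \ {0} := by
      intro x hx
      rw [mem_ball, dist_eq_norm] at hx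
      constructor
      · rw [mem_ball_zero_iff]
        have := norm_le_norm_add_norm_sub' x w
        linarith
      · rintro rfl
        rw [zero_sub, norm_neg] at hx
        linarith
    have h2 : IntegrableOn (fun w => g w ^ 2) (ball w (‖w‖ / 2)) := by
      have : IntegrableOn (fun w => ‖g w ^ 2‖) (ball w (‖w‖ / 2)) := by
        simpa only [norm_pow] using hsq.mono_set hsub
      refine (integrable_norm_iff ?_).1 this
      exact ((hg.pow 2).continuousOn.mono hsub).aestronglyMeasurable measurableSet_ball
    have key := integral_ball_eq_of_differentiableOn (half_pos hpos)
      ((hg.pow 2).mono hsub) h2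
    have h3 : Real.pi * (‖w‖ / 2) ^ 2 * ‖g w‖ ^ 2 ≤ ∫ x in ball w (‖w‖ / 2), ‖g x‖ ^ 2 := by
      have := norm_integral_le_integral_norm (μ := volume.restrict (ball w (‖w‖ / 2)))
        (fun x => g x ^ 2)
      simp only [Pi.pow_apply] at key
      rw [key] at this
      simpa [abs_of_pos Real.pi_pos] using this
    rw [Measure.restrict_restrict_of_subset hsub, norm_mul, mul_pow]
    calc ‖w‖ ^ 2 * ‖g w‖ ^ 2
        = 4 / Real.pi * (Real.pi * (‖w‖ / 2) ^ 2 * ‖g w‖ ^ 2) := by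
          field_simp; norm_num
      _ ≤ _ := by gcongr
  have hvol : Tendsto ((volume.restrict (ball (0 : ℂ) 1 \ {0})) ∘ fun w : ℂ => ball w (‖w‖ / 2))
      (𝓝[≠] 0) (𝓝 0) := by
    have h0 : Tendsto (fun w : ℂ => ENNReal.ofReal (‖w‖ / 2) ^ 2 * NNReal.pi) (𝓝[≠] 0) (𝓝 0) := by
      have hc : Continuous (fun w : ℂ => ENNReal.ofReal (‖w‖ / 2) ^ 2 * NNReal.pi) := by
        refine ENNReal.continuous_mul_const (by simp) |>.comp ?_
        exact (ENNReal.continuous_pow 2).comp (ENNReal.continuous_ofReal.comp (by fun_prop))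
      simpa using (hc.tendsto 0).mono_left nhdsWithin_le_nhds
    refine tendsto_of_tendsto_of_tendsto_of_le_of_le tendsto_const_nhds h0 (fun _ => zero_le)
      fun w => ?_
    refine (Measure.restrict_apply_le _ _).trans ?_
    rw [Complex.volume_ball]
  have hint := Integrable.tendsto_setIntegral_nhds_zero hsq hvol
  have hlim : Tendsto (fun w => w * g w) (𝓝[≠] 0) (𝓝 0) := by
    have h1 : Tendsto (fun w => ‖w * g w‖ ^ 2) (𝓝[≠] 0) (𝓝 0) := by
      refine tendsto_of_tendsto_of_tendsto_of_le_of_le' tendsto_const_nhds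
        (by simpa using hint.const_mul (4 / Real.pi))
        (Eventually.of_forall fun _ => by positivity) ?_
      filter_upwards [self_mem_nhdsWithin,
        nhdsWithin_le_nhds (ball_mem_nhds (0 : ℂ) (half_pos one_pos))] with w hw hw'
      exact hbound w hw (by simpa using hw')
    rw [tendsto_zero_iff_norm_tendsto_zero]
    simpa only [Real.sqrt_sq (norm_nonneg _), Real.sqrt_zero] using h1.sqrt
  refine Asymptotics.isLittleO_of_tendsto' ?_ ?_
  · filter_upwards [self_mem_nhdsWithin] with w hw h
    simp at h
    exact absurd h hw
  · have h2 : Tendsto (fun w : ℂ => w * g 0) (𝓝[≠] 0) (𝓝 0) := by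
      have : Continuous fun w : ℂ => w * g 0 := by fun_prop
      simpa using (this.tendsto 0).mono_left nhdsWithin_le_nhds
    have h3 := hlim.sub h2
    rw [sub_zero] at h3
    refine h3.congr fun w => ?_
    simp only [sub_zero, div_inv_eq_mul]
    ring

theorem volume_restrict_punctured :
    volume.restrict (ball (0 : ℂ) 1 \ {0}) = volume.restrict (ball (0 : ℂ) 1) :=
  Measure.restrict_congr_set (sdiff_null_ae_eq_self (measure_singleton 0))

instance isFiniteMeasure_restrict_punctured :
    IsFiniteMeasure (volume.restrict (ball (0 : ℂ) 1 \ {0})) := by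
  rw [volume_restrict_punctured]
  exact isFiniteMeasure_restrict.2 measure_ball_lt_top.ne

theorem integrable_of_memLp_two {α : Type*} [MeasurableSpace α] {μ : Measure α}
    [IsFiniteMeasure μ] {g : α → ℂ} (h : MemLp g 2 μ) : Integrable g μ :=
  h.integrable (by norm_num)

theorem punctured_disc_reproducing {g : ℂ → ℂ} (hg : DifferentiableOn ℂ g (ball 0 1 \ {0}))
    (hL : MemLp g 2 (volume.restrict (ball 0 1 \ {0}))) {z : ℂ} (hz : z ∈ ball (0 : ℂ) 1 \ {0}) :
    ∫ w in ball 0 1 \ {0}, g w / (1 - z * conj w) ^ 2 = Real.pi * g z := by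
  obtain ⟨G, hG, hGg⟩ := exists_differentiableOn_extension_of_memLp hg hL
  have hm : MeasurableSet (ball (0 : ℂ) 1 \ {0}) :=
    measurableSet_ball.diff (measurableSet_singleton 0)
  have hi : IntegrableOn G (ball 0 1) := by
    have : IntegrableOn G (ball 0 1 \ {0}) :=
      IntegrableOn.congr_fun (integrable_of_memLp_two hL) hGg.symm hm
    rwa [IntegrableOn, volume_restrict_punctured] at this
  rw [← hGg hz, ← disc_reproducing hG hi (by simpa using hz.1), ← volume_restrict_punctured]
  refine setIntegral_congr_fun hm fun w hw => ?_
  simp only [hGg hw]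

/-- The product of the unit disc and the punctured unit disc. -/
def discProdPunctured : Set (ℂ × ℂ) := ball 0 1 ×ˢ (ball 0 1 \ {0})

theorem isOpen_discProdPunctured : IsOpen discProdPunctured :=
  isOpen_ball.prod (isOpen_ball.sdiff isClosed_singleton)

theorem volume_restrict_discProdPunctured :
    volume.restrict discProdPunctured =
      (volume.restrict (ball (0 : ℂ) 1)).prod (volume.restrict (ball (0 : ℂ) 1 \ {0})) := by
  rw [Measure.prod_restrict]; rfl

instance isFiniteMeasure_restrict_discProdPunctured :
    IsFiniteMeasure (volume.restrict discProdPunctured) := by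
  have : IsFiniteMeasure (volume.restrict (ball (0 : ℂ) 1)) :=
    isFiniteMeasure_restrict.2 measure_ball_lt_top.ne
  rw [volume_restrict_discProdPunctured]
  infer_instance

theorem norm_inv_bidisc_kernel_le {p q : ℂ × ℂ} (hp : p ∈ discProdPunctured)
    (hq : q ∈ discProdPunctured) :
    ‖((1 - p.1 * conj q.1) ^ 2 * (1 - p.2 * conj q.2) ^ 2)⁻¹‖ ≤
      ((1 - ‖p.1‖) ^ 2)⁻¹ * ((1 - ‖p.2‖) ^ 2)⁻¹ := by
  rw [mul_inv, norm_mul]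
  exact mul_le_mul (norm_inv_one_sub_sq_le (by simpa using hp.1) (by simpa using hq.1))
    (norm_inv_one_sub_sq_le (by simpa using hp.2.1) (by simpa using hq.2.1)) (norm_nonneg _)
    (by positivity)

theorem integrableOn_bidisc_kernel {G : ℂ × ℂ → ℂ} (hG : IntegrableOn G discProdPunctured)
    {p : ℂ × ℂ} (hp : p ∈ discProdPunctured) :
    IntegrableOn (fun q : ℂ × ℂ => G q / ((1 - p.1 * conj q.1) ^ 2 * (1 - p.2 * conj q.2) ^ 2))
      discProdPunctured := by
  have hconj : Measurable (fun w : ℂ => conj w) := Complex.continuous_conj.measurable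
  simp only [div_eq_mul_inv]
  exact Integrable.mul_bdd hG (Measurable.aestronglyMeasurable (by fun_prop))
    (ae_restrict_of_forall_mem isOpen_discProdPunctured.measurableSet fun q hq =>
      norm_inv_bidisc_kernel_le hp hq)

/-- The reproducing formula of the product of the disc and the punctured disc. -/
theorem bidisc_reproducing {G : ℂ × ℂ → ℂ} (hG : DifferentiableOn ℂ G discProdPunctured)
    (hL : MemLp G 2 (volume.restrict discProdPunctured)) {p : ℂ × ℂ} (hp : p ∈ discProdPunctured) :
    ∫ q in discProdPunctured,
      G q / ((1 - p.1 * conj q.1) ^ 2 * (1 - p.2 * conj q.2) ^ 2) = Real.pi ^ 2 * G p := by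
  set D : Set ℂ := ball 0 1
  set D' : Set ℂ := ball 0 1 \ {0}
  have hD' : MeasurableSet D' := measurableSet_ball.diff (measurableSet_singleton 0)
  have hfin : IsFiniteMeasure (volume.restrict D) :=
    isFiniteMeasure_restrict.2 measure_ball_lt_top.ne
  have hfin' : IsFiniteMeasure (volume.restrict D') := isFiniteMeasure_restrict_punctured
  have hp1 : ‖p.1‖ < 1 := by simpa using hp.1
  have hμ : volume.restrict discProdPunctured = (volume.restrict D).prod (volume.restrict D') :=
    volume_restrict_discProdPunctured
  rw [hμ] at hL ⊢
  have hGi := integrable_of_memLp_two hL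
  have hGsq : Integrable (fun q => ‖G q‖ ^ 2) ((volume.restrict D).prod (volume.restrict D')) :=
    (memLp_two_iff_integrable_sq_norm hL.1).1 hL
  have hI := integrableOn_bidisc_kernel (hμ ▸ hGi) hp
  rw [IntegrableOn, hμ] at hI
  rw [integral_prod_symm _ hI]
  have hslice1 : ∀ v ∈ D', DifferentiableOn ℂ (fun u => G (u, v)) D := fun v hv =>
    hG.comp (by fun_prop) fun u hu => ⟨hu, hv⟩
  have hslice2 : DifferentiableOn ℂ (fun v => G (p.1, v)) D' :=
    hG.comp (by fun_prop) fun v hv => ⟨hp.1, hv⟩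
  have hae := hGi.prod_left_ae
  have haesq := hGsq.prod_left_ae
  have hae' : ∀ᵐ v ∂(volume.restrict D'), v ∈ D' := ae_restrict_mem hD'
  -- The slice `G (p.1, ·)` is square-integrable: apply the disc formula to `G (·, v) ^ 2`.
  have hsliceL : MemLp (fun v => G (p.1, v)) 2 (volume.restrict D') := by
    have hm : AEStronglyMeasurable (fun v => G (p.1, v)) (volume.restrict D') :=
      hslice2.continuousOn.aestronglyMeasurable hD'
    rw [memLp_two_iff_integrable_sq_norm hm]
    refine Integrable.mono' ((hGsq.integral_prod_right).const_mul
      (Real.pi⁻¹ * ((1 - ‖p.1‖) ^ 2)⁻¹)) (hm.norm.pow 2) ?_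
    filter_upwards [haesq, hae'] with v hv hv'
    have hi2 : IntegrableOn (fun u => G (u, v) ^ 2) D := by
      have : IntegrableOn (fun u => ‖G (u, v) ^ 2‖) D := by
        simp only [norm_pow]; exact hv
      exact (integrable_norm_iff
        (((hslice1 v hv').pow 2).continuousOn.aestronglyMeasurable measurableSet_ball)).1 this
    have key := disc_reproducing ((hslice1 v hv').pow 2) hi2 hp1
    have hle : ‖∫ u in D, G (u, v) ^ 2 / (1 - p.1 * conj u) ^ 2‖ ≤
        ∫ u in D, ‖G (u, v)‖ ^ 2 * ((1 - ‖p.1‖) ^ 2)⁻¹ := by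
      refine norm_integral_le_of_norm_le (hv.mul_const _) ?_
      refine ae_restrict_of_forall_mem measurableSet_ball fun u hu => ?_
      rw [div_eq_mul_inv, norm_mul, norm_pow]
      exact mul_le_mul_of_nonneg_left (norm_inv_one_sub_sq_le hp1 (by simpa [D] using hu))
        (by positivity)
    simp only [Pi.pow_apply] at key
    rw [key, integral_mul_const, norm_mul, norm_pow, Complex.norm_real, Real.norm_eq_abs,
      abs_of_pos Real.pi_pos] at hle
    rw [norm_pow, norm_norm]
    calc ‖G (p.1, v)‖ ^ 2 = Real.pi⁻¹ * (Real.pi * ‖G (p.1, v)‖ ^ 2) := by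
          field_simp
      _ ≤ Real.pi⁻¹ * ((∫ u in D, ‖G (u, v)‖ ^ 2) * ((1 - ‖p.1‖) ^ 2)⁻¹) := by gcongr
      _ = _ := by ring
  have hinner : ∀ᵐ v ∂(volume.restrict D'),
      ∫ u in D, G (u, v) / ((1 - p.1 * conj u) ^ 2 * (1 - p.2 * conj v) ^ 2) =
        Real.pi * (G (p.1, v) / (1 - p.2 * conj v) ^ 2) := by
    filter_upwards [hae, hae'] with v hv hv'
    simp only [← div_div]
    rw [integral_div, disc_reproducing (hslice1 v hv') hv hp1, mul_div_assoc]
  rw [integral_congr_ae hinner, integral_const_mul, punctured_disc_reproducing hslice2 hsliceL hp.2]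
  ring

/-! ### The covering of the Hartogs triangle -/

/-- The covering map `(u, v) ↦ (u v, v ^ k)`, which sends `discProdPunctured` onto the Hartogs
triangle of exponent `k`. -/
def hartogsCover (k : ℕ) (q : ℂ × ℂ) : ℂ × ℂ := (q.1 * q.2, q.2 ^ k)

theorem mem_hartogsTriangle_natCast {k : ℕ} {z : ℂ × ℂ} :
    z ∈ hartogsTriangle (k : ℝ) ↔ ‖z.1‖ ^ k < ‖z.2‖ ∧ ‖z.2‖ < 1 := by
  simp [hartogsTriangle]

theorem isOpen_hartogsTriangle_natCast (k : ℕ) : IsOpen (hartogsTriangle (k : ℝ)) := by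
  have : hartogsTriangle (k : ℝ) = {z | ‖z.1‖ ^ k < ‖z.2‖} ∩ {z | ‖z.2‖ < 1} := by
    ext z; exact mem_hartogsTriangle_natCast
  rw [this]
  exact (isOpen_lt (by fun_prop) (by fun_prop)).inter (isOpen_lt (by fun_prop) (by fun_prop))

theorem mem_discProdPunctured {q : ℂ × ℂ} :
    q ∈ discProdPunctured ↔ ‖q.1‖ < 1 ∧ ‖q.2‖ < 1 ∧ q.2 ≠ 0 := by
  simp [discProdPunctured]

theorem hartogsCover_mem {k : ℕ} (hk : k ≠ 0) {q : ℂ × ℂ} (hq : q ∈ discProdPunctured) :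
    hartogsCover k q ∈ hartogsTriangle (k : ℝ) := by
  obtain ⟨h1, h2, h3⟩ := mem_discProdPunctured.1 hq
  rw [mem_hartogsTriangle_natCast]
  simp only [hartogsCover, norm_mul, mul_pow, norm_pow]
  exact ⟨mul_lt_of_lt_one_left (pow_pos (norm_pos_iff.2 h3) k)
    (pow_lt_one₀ (norm_nonneg _) h1 hk), pow_lt_one₀ (norm_nonneg _) h2 hk⟩

/-- For a `k`-th root of unity `c`, the points `(u, v)` of `discProdPunctured` for which `v` is `c`
times the principal `k`-th root of `v ^ k`. It is a measurable fundamental domain of the covering,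
not an open one. -/
def hartogsSheet (k : ℕ) (c : ℂ) : Set (ℂ × ℂ) :=
  {q ∈ discProdPunctured | q.2 = c * (q.2 ^ k) ^ (k⁻¹ : ℂ)}

theorem measurableSet_hartogsSheet (k : ℕ) (c : ℂ) : MeasurableSet (hartogsSheet k c) :=
  isOpen_discProdPunctured.measurableSet.inter
    (measurableSet_eq_fun (by fun_prop) (by fun_prop))

theorem injOn_hartogsCover_sheet (k : ℕ) (c : ℂ) : InjOn (hartogsCover k) (hartogsSheet k c) := by
  rintro ⟨u, v⟩ ⟨hq, h⟩ ⟨u', v'⟩ ⟨-, h'⟩ he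
  simp only [hartogsCover, Prod.mk.injEq] at he h h'
  have hv : v = v' := by rw [h, h', he.2]
  have hv0 : v ≠ 0 := (mem_discProdPunctured.1 hq).2.2
  subst hv
  rw [mul_right_cancel₀ hv0 he.1]

theorem image_hartogsCover_sheet {k : ℕ} (hk : k ≠ 0) {c : ℂ} (hc : c ^ k = 1) :
    hartogsCover k '' hartogsSheet k c = hartogsTriangle (k : ℝ) := by
  refine Subset.antisymm (image_subset_iff.2 fun q hq => hartogsCover_mem hk hq.1) fun z hz => ?_
  obtain ⟨h1, h2⟩ := mem_hartogsTriangle_natCast.1 hz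
  set v : ℂ := c * z.2 ^ (k⁻¹ : ℂ) with hv
  have hvk : v ^ k = z.2 := by rw [hv, mul_pow, hc, one_mul, Complex.cpow_nat_inv_pow _ hk]
  have hz2 : z.2 ≠ 0 := norm_pos_iff.1 ((pow_nonneg (norm_nonneg _) k).trans_lt h1)
  have hv0 : v ≠ 0 := by
    intro h0; rw [h0, zero_pow hk] at hvk; exact hz2 hvk.symm
  have hvpos := norm_pos_iff.2 hv0
  rw [← hvk, norm_pow] at h1 h2
  refine ⟨(z.1 / v, v), ⟨mem_discProdPunctured.2 ⟨?_, ?_, hv0⟩, ?_⟩, ?_⟩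
  · rw [norm_div, div_lt_one hvpos]
    exact lt_of_pow_lt_pow_left₀ k hvpos.le h1
  · exact (pow_lt_one_iff_of_nonneg hvpos.le hk).1 h2
  · simp only [hvk]; exact hv
  · ext
    · simp [hartogsCover, hv0]
    · simp [hartogsCover, hvk]

theorem iUnion_hartogsSheet {k : ℕ} (hk : k ≠ 0) {ζ : ℂ} (hζ : IsPrimitiveRoot ζ k) :
    ⋃ j : Fin k, hartogsSheet k (ζ ^ (j : ℕ)) = discProdPunctured := by
  refine Subset.antisymm (iUnion_subset fun j => sep_subset _ _) fun q hq => ?_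
  have : NeZero k := ⟨hk⟩
  have h0 : q.2 ≠ 0 := (mem_discProdPunctured.1 hq).2.2
  set r : ℂ := (q.2 ^ k) ^ (k⁻¹ : ℂ) with hr
  have hrk : r ^ k = q.2 ^ k := Complex.cpow_nat_inv_pow _ hk
  have hr0 : r ≠ 0 := by
    intro h; rw [h, zero_pow hk] at hrk; exact pow_ne_zero k h0 hrk.symm
  have h1 : (q.2 / r) ^ k = 1 := by rw [div_pow, hrk, div_self (pow_ne_zero k h0)]
  obtain ⟨j, hj, hj'⟩ := hζ.eq_pow_of_pow_eq_one h1
  refine mem_iUnion.2 ⟨⟨j, hj⟩, hq, ?_⟩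
  simp only [← hr, hj']
  field_simp

theorem pairwise_disjoint_hartogsSheet {k : ℕ} {ζ : ℂ} (hζ : IsPrimitiveRoot ζ k) :
    Pairwise (Function.onFun Disjoint fun j : Fin k => hartogsSheet k (ζ ^ (j : ℕ))) := by
  intro i j hij
  refine disjoint_left.2 fun q hq hq' => hij (Fin.ext (hζ.pow_inj i.2 j.2 ?_))
  have h0 : q.2 ≠ 0 := (mem_discProdPunctured.1 hq.1).2.2
  have hne : (q.2 ^ k) ^ (k⁻¹ : ℂ) ≠ 0 := by
    intro h'; have := hq.2; rw [h', mul_zero] at this; exact h0 this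
  have h1 := hq.2.symm.trans hq'.2
  exact mul_right_cancel₀ hne h1

/-- The complex derivative of the covering map, as the Jacobian matrix. -/
noncomputable def hartogsCoverDeriv (k : ℕ) (q : ℂ × ℂ) : ℂ × ℂ →L[ℂ] ℂ × ℂ :=
  LinearMap.toContinuousLinearMap (Matrix.toLin (Module.Basis.finTwoProd ℂ)
    (Module.Basis.finTwoProd ℂ) !![q.2, q.1; 0, k * q.2 ^ (k - 1)])

theorem hasFDerivAt_hartogsCover (k : ℕ) (q : ℂ × ℂ) :
    HasFDerivAt (hartogsCover k) (hartogsCoverDeriv k q) q := by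
  unfold hartogsCoverDeriv
  rw [Matrix.toLin_finTwoProd_toContinuousLinearMap]
  refine HasFDerivAt.prodMk ?_ ?_
  · refine (hasFDerivAt_fst.mul hasFDerivAt_snd).congr_fderiv ?_
    rw [add_comm]
  · refine ((hasDerivAt_pow k q.2).comp_hasFDerivAt q hasFDerivAt_snd).congr_fderiv ?_
    exact ContinuousLinearMap.ext fun x => by simp

/-- The real Jacobian determinant is the squared modulus of the complex one. -/
theorem det_hartogsCoverDeriv {k : ℕ} (hk : k ≠ 0) (q : ℂ × ℂ) :
    ((hartogsCoverDeriv k q).restrictScalars ℝ).det = ‖k * q.2 ^ k‖ ^ 2 := by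
  have h1 : ((hartogsCoverDeriv k q).restrictScalars ℝ).det =
      (((hartogsCoverDeriv k q : ℂ × ℂ →L[ℂ] ℂ × ℂ) :
        ℂ × ℂ →ₗ[ℂ] ℂ × ℂ).restrictScalars ℝ).det := rfl
  have h2 : ((hartogsCoverDeriv k q : ℂ × ℂ →L[ℂ] ℂ × ℂ) : ℂ × ℂ →ₗ[ℂ] ℂ × ℂ).det =
      k * q.2 ^ k := by
    rw [hartogsCoverDeriv, LinearMap.coe_toContinuousLinearMap, LinearMap.det_toLin,
      Matrix.det_fin_two_of]
    obtain ⟨n, rfl⟩ := Nat.exists_eq_succ_of_ne_zero hk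
    simp only [Nat.succ_eq_add_one, Nat.add_sub_cancel]
    ring
  rw [h1, LinearMap.det_restrictScalars, h2, Algebra.norm_complex_eq]
  exact Complex.normSq_eq_norm_sq _

theorem continuous_hartogsCover (k : ℕ) : Continuous (hartogsCover k) := by
  unfold hartogsCover; fun_prop

/-- The `k`-to-one change of variables: each sheet contributes one copy of Lebesgue measure on the
Hartogs triangle. -/
theorem map_hartogsCover {k : ℕ} (hk : k ≠ 0) :
    Measure.map (hartogsCover k) ((volume.restrict discProdPunctured).withDensity
      fun q => ENNReal.ofReal (‖(k : ℂ) * q.2 ^ k‖ ^ 2)) =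
      (k : ENNReal) • volume.restrict (hartogsTriangle (k : ℝ)) := by
  have hζ := Complex.isPrimitiveRoot_exp k hk
  set ζ := Complex.exp (2 * Real.pi * Complex.I / k)
  rw [← iUnion_hartogsSheet hk hζ, Measure.restrict_iUnion (pairwise_disjoint_hartogsSheet hζ)
    fun j => measurableSet_hartogsSheet _ _, withDensity_sum,
    Measure.map_sum (continuous_hartogsCover k).aemeasurable]
  have hj : ∀ j : Fin k, Measure.map (hartogsCover k)
      ((volume.restrict (hartogsSheet k (ζ ^ (j : ℕ)))).withDensity
        fun q => ENNReal.ofReal (‖(k : ℂ) * q.2 ^ k‖ ^ 2)) =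
      volume.restrict (hartogsTriangle (k : ℝ)) := by
    intro j
    have hc : (ζ ^ (j : ℕ)) ^ k = 1 := by rw [← pow_mul, mul_comm, pow_mul, hζ.pow_eq_one, one_pow]
    have hHaar : (volume : Measure (ℂ × ℂ)).IsAddHaarMeasure :=
      Measure.prod.instIsAddHaarMeasure _ _
    have := map_withDensity_abs_det_fderiv_eq_addHaar (volume : Measure (ℂ × ℂ))
      (measurableSet_hartogsSheet k (ζ ^ (j : ℕ))).nullMeasurableSet
      (fun q _ => ((hasFDerivAt_hartogsCover k q).restrictScalars ℝ).hasFDerivWithinAt)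
      (injOn_hartogsCover_sheet k _)
    rw [image_hartogsCover_sheet hk hc] at this
    rw [← this]
    simp only [det_hartogsCoverDeriv hk, abs_pow, abs_norm]
  simp only [hj, Measure.sum_fintype, Finset.sum_const, Finset.card_univ, Fintype.card_fin]
  rw [Nat.cast_smul_eq_nsmul]

theorem measurable_jacobian (k : ℕ) :
    Measurable fun q : ℂ × ℂ => ENNReal.ofReal (‖(k : ℂ) * q.2 ^ k‖ ^ 2) := by
  fun_prop

theorem setIntegral_hartogsCover {k : ℕ} (hk : k ≠ 0) {h : ℂ × ℂ → ℂ}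
    (hh : AEStronglyMeasurable h (volume.restrict (hartogsTriangle (k : ℝ)))) :
    ∫ q in discProdPunctured, ‖(k : ℂ) * q.2 ^ k‖ ^ 2 • h (hartogsCover k q) =
      k * ∫ w in hartogsTriangle (k : ℝ), h w := by
  have h1 : ∫ w, h w ∂((k : ENNReal) • volume.restrict (hartogsTriangle (k : ℝ))) =
      k * ∫ w in hartogsTriangle (k : ℝ), h w := by
    rw [integral_smul_measure]; simp
  rw [← h1, ← map_hartogsCover hk, integral_map (continuous_hartogsCover k).aemeasurable,
    integral_withDensity_eq_integral_toReal_smul (measurable_jacobian k) (by simp)]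
  · simp only [ENNReal.toReal_ofReal (sq_nonneg _)]
  · rw [map_hartogsCover hk]
    exact hh.smul_measure _

/-- The pullback `f ↦ k v ^ k (f ∘ Φ)` preserves and reflects square-integrability. -/
theorem memLp_hartogsCover_iff {k : ℕ} (hk : k ≠ 0) {f : ℂ × ℂ → ℂ}
    (hf : ContinuousOn f (hartogsTriangle (k : ℝ))) :
    MemLp (fun q => (k : ℂ) * q.2 ^ k * f (hartogsCover k q)) 2
      (volume.restrict discProdPunctured) ↔
      MemLp f 2 (volume.restrict (hartogsTriangle (k : ℝ))) := by
  have hm : AEStronglyMeasurable f (volume.restrict (hartogsTriangle (k : ℝ))) :=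
    hf.aestronglyMeasurable (isOpen_hartogsTriangle_natCast k).measurableSet
  have hm' : AEStronglyMeasurable (fun q => (k : ℂ) * q.2 ^ k * f (hartogsCover k q))
      (volume.restrict discProdPunctured) := by
    refine ContinuousOn.aestronglyMeasurable ?_ isOpen_discProdPunctured.measurableSet
    refine ContinuousOn.mul (by fun_prop) ?_
    exact hf.comp (continuous_hartogsCover k).continuousOn fun q hq => hartogsCover_mem hk hq
  rw [memLp_two_iff_integrable_sq_norm hm, memLp_two_iff_integrable_sq_norm hm',
    ← integrable_smul_measure (μ := volume.restrict (hartogsTriangle (k : ℝ)))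
      (c := (k : ENNReal)) (by simpa using hk) (by simp),
    ← map_hartogsCover hk, integrable_map_measure, integrable_withDensity_iff_integrable_smul'
      (measurable_jacobian k) (by simp)]
  · simp only [ENNReal.toReal_ofReal (sq_nonneg _), Function.comp_apply, smul_eq_mul,
      norm_mul _ (f _), mul_pow _ ‖f _‖]
  · rw [map_hartogsCover hk]
    exact (hm.norm.pow 2).smul_measure _
  · exact (continuous_hartogsCover k).aemeasurable

/-! ### The sum over the roots of unity -/

/-- The expansion of `((1 - x ^ n) / (1 - x)) ^ 2` as a polynomial of degree less than `n` in `x`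
whose coefficients are affine in `x ^ n`. -/
theorem sq_one_sub_mul_sum (x : ℂ) (n : ℕ) :
    (1 - x) ^ 2 * ∑ m ∈ Finset.range n, ((m : ℂ) + 1 + (n - (m + 1)) * x ^ n) * x ^ m =
      (1 - x ^ n) ^ 2 := by
  have h1 : ∀ n : ℕ, (1 - x) ^ 2 * ∑ m ∈ Finset.range n, ((m : ℂ) + 1) * x ^ m =
      1 - (n + 1) * x ^ n + n * x ^ (n + 1) := by
    intro n
    induction n with
    | zero => simp
    | succ n ih => rw [Finset.sum_range_succ, mul_add, ih]; push_cast; ring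
  have h2 : (1 - x) ^ 2 * ∑ m ∈ Finset.range n, x ^ m = (1 - x) * (1 - x ^ n) := by
    rw [sq, mul_assoc, mul_neg_geom_sum]
  have h3 : ∑ m ∈ Finset.range n, ((m : ℂ) + 1 + (n - (m + 1)) * x ^ n) * x ^ m =
      (1 - x ^ n) * ∑ m ∈ Finset.range n, ((m : ℂ) + 1) * x ^ m +
        n * x ^ n * ∑ m ∈ Finset.range n, x ^ m := by
    rw [Finset.mul_sum, Finset.mul_sum, ← Finset.sum_add_distrib]
    exact Finset.sum_congr rfl fun m _ => by ring
  rw [h3, mul_add, mul_left_comm, h1, mul_left_comm, h2]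
  ring

theorem sum_rootOfUnity_orthogonality {k : ℕ} {ζ : ℂ} (hζ : IsPrimitiveRoot ζ k) {m n : ℕ}
    (hm : m < k) (hn : n < k) :
    ∑ j ∈ Finset.range k, ((ζ ^ j)⁻¹) ^ m * (ζ ^ j) ^ n = if m = n then (k : ℂ) else 0 := by
  have hζ0 : ζ ≠ 0 := hζ.ne_zero (by omega)
  have h1 : ∀ j, ((ζ ^ j)⁻¹) ^ m * (ζ ^ j) ^ n = (ζ ^ n / ζ ^ m) ^ j := by
    intro j
    rw [div_pow, inv_pow, ← pow_mul, ← pow_mul, ← pow_mul, ← pow_mul, mul_comm j, mul_comm j,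
      div_eq_inv_mul]
  simp only [h1]
  split_ifs with h
  · subst h; simp [hζ0]
  · have hne : ζ ^ n / ζ ^ m ≠ 1 := by
      intro h'
      rw [div_eq_one_iff_eq (pow_ne_zero _ hζ0)] at h'
      exact h (hζ.pow_inj hn hm h').symm
    have h2 := mul_geom_sum (ζ ^ n / ζ ^ m) k
    have h3 : (ζ ^ n / ζ ^ m) ^ k = 1 := by
      rw [div_pow, ← pow_mul, ← pow_mul, mul_comm n, mul_comm m, pow_mul, pow_mul, hζ.pow_eq_one]
      simp
    rw [h3, sub_self] at h2
    exact (mul_eq_zero.1 h2).resolve_left (sub_ne_zero.2 hne)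

/-- The diagonal terms that survive the sum over the roots of unity, collected into `hartogsP` and
`hartogsQ`. -/
theorem sum_range_eq_hartogs (k : ℕ) (A B s : ℂ) (hAB : A * B = s ^ k) :
    ∑ m ∈ Finset.range k, ((m : ℂ) + 1 + (k - (m + 1)) * A) * (m + 1 + (k - (m + 1)) * B) * s ^ m =
      hartogsP k s * B + hartogsQ k s + A * hartogsP k s := by
  have hP : hartogsP k s = ∑ m ∈ Finset.range k, ((m : ℂ) + 1) * (k - (m + 1)) * s ^ m := by
    unfold hartogsP
    cases k with
    | zero => simp
    | succ n =>
      rw [Finset.sum_range_succ, Nat.add_sub_cancel, ← Finset.Ico_add_one_right_eq_Icc,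
        Finset.sum_Ico_eq_sum_range]
      push_cast
      rw [sub_self, mul_zero, zero_mul, add_zero]
      refine Finset.sum_congr rfl fun m _ => ?_
      rw [Nat.add_sub_cancel_left]
      ring
  have hQ : hartogsQ k s =
      ∑ m ∈ Finset.range k, (((m : ℂ) + 1) ^ 2 + (k - (m + 1)) ^ 2 * s ^ k) * s ^ m := by
    unfold hartogsQ
    rw [← Finset.Ico_add_one_right_eq_Icc, Finset.sum_Ico_eq_sum_range]
    refine Finset.sum_congr rfl fun m _ => ?_
    rw [Nat.add_sub_cancel_left]
    push_cast
    ring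
  rw [hP, hQ, Finset.sum_mul, Finset.mul_sum, ← Finset.sum_add_distrib, ← Finset.sum_add_distrib]
  refine Finset.sum_congr rfl fun m _ => ?_
  rw [← hAB]; ring

theorem sum_deck_eq {k : ℕ} {ζ : ℂ} (hζ : IsPrimitiveRoot ζ k) {a b : ℂ}
    (ha : 1 - a ^ k ≠ 0) (hb : 1 - b ^ k ≠ 0) :
    ∑ j ∈ Finset.range k, 1 / ((1 - (ζ ^ j)⁻¹ * a) ^ 2 * (1 - ζ ^ j * b) ^ 2) =
      k * (hartogsP k (a * b) * b ^ k + hartogsQ k (a * b) + a ^ k * hartogsP k (a * b)) /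
        ((1 - a ^ k) ^ 2 * (1 - b ^ k) ^ 2) := by
  have hroot : ∀ j, (ζ ^ j) ^ k = 1 := fun j => by
    rw [← pow_mul, mul_comm, pow_mul, hζ.pow_eq_one, one_pow]
  have hfrac : ∀ c x : ℂ, c ^ k = 1 → 1 - x ^ k ≠ 0 → 1 / (1 - c * x) ^ 2 =
      (∑ m ∈ Finset.range k, ((m : ℂ) + 1 + (k - (m + 1)) * x ^ k) * (c * x) ^ m) /
        (1 - x ^ k) ^ 2 := by
    intro c x hc hx
    have h := sq_one_sub_mul_sum (c * x) k
    rw [mul_pow c x k, hc, one_mul] at h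
    have hne : (1 - c * x) ^ 2 ≠ 0 := by
      intro h0; rw [h0, zero_mul] at h; exact pow_ne_zero 2 hx h.symm
    rw [div_eq_div_iff hne (pow_ne_zero 2 hx), one_mul, ← h]; ring
  have hterm : ∀ j ∈ Finset.range k,
      1 / ((1 - (ζ ^ j)⁻¹ * a) ^ 2 * (1 - ζ ^ j * b) ^ 2) =
      (∑ m ∈ Finset.range k, ∑ n ∈ Finset.range k,
        (((m : ℂ) + 1 + (k - (m + 1)) * a ^ k) * ((n : ℂ) + 1 + (k - (n + 1)) * b ^ k) *
          (a ^ m * b ^ n)) * (((ζ ^ j)⁻¹) ^ m * (ζ ^ j) ^ n)) /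
        ((1 - a ^ k) ^ 2 * (1 - b ^ k) ^ 2) := by
    intro j _
    rw [← one_div_mul_one_div, hfrac _ a (by rw [inv_pow, hroot, inv_one]) ha,
      hfrac _ b (hroot j) hb, div_mul_div_comm, Finset.sum_mul_sum]
    congr 1
    refine Finset.sum_congr rfl fun m _ => Finset.sum_congr rfl fun n _ => ?_
    ring
  rw [Finset.sum_congr rfl hterm, ← Finset.sum_div, Finset.sum_comm]
  congr 1
  rw [← sum_range_eq_hartogs k (a ^ k) (b ^ k) (a * b) (mul_pow a b k).symm, Finset.mul_sum]
  refine Finset.sum_congr rfl fun m hm => ?_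
  rw [Finset.sum_comm]
  have : ∀ n ∈ Finset.range k, ∑ j ∈ Finset.range k,
      (((m : ℂ) + 1 + (k - (m + 1)) * a ^ k) * ((n : ℂ) + 1 + (k - (n + 1)) * b ^ k) *
          (a ^ m * b ^ n)) * (((ζ ^ j)⁻¹) ^ m * (ζ ^ j) ^ n) =
      if m = n then (((m : ℂ) + 1 + (k - (m + 1)) * a ^ k) *
        ((n : ℂ) + 1 + (k - (n + 1)) * b ^ k) * (a ^ m * b ^ n)) * k else 0 := by
    intro n hn
    rw [← Finset.mul_sum, sum_rootOfUnity_orthogonality hζ (Finset.mem_range.1 hm)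
      (Finset.mem_range.1 hn)]
    split_ifs <;> simp
  rw [Finset.sum_congr rfl this, Finset.sum_ite_eq, if_pos hm]
  ring

theorem hartogsFormula_eq_sum_deck {k : ℕ} (hk : k ≠ 0) {ζ : ℂ} (hζ : IsPrimitiveRoot ζ k)
    {a b : ℂ} (ha : 1 - a ^ k ≠ 0) (hb : 1 - b ^ k ≠ 0) (hb0 : b ≠ 0) :
    hartogsFormula k (a * b) (b ^ k) = 1 / ((k : ℂ) ^ 2 * Real.pi ^ 2 * b ^ k) *
      ∑ j ∈ Finset.range k, 1 / ((1 - (ζ ^ j)⁻¹ * a) ^ 2 * (1 - ζ ^ j * b) ^ 2) := by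
  rw [sum_deck_eq hζ ha hb, hartogsFormula]
  have hpi : (Real.pi : ℂ) ≠ 0 := by exact_mod_cast Real.pi_ne_zero
  have hk0 : (k : ℂ) ≠ 0 := by exact_mod_cast hk
  have hB : b ^ k ≠ 0 := pow_ne_zero k hb0
  have h1 : b ^ k - (a * b) ^ k = b ^ k * (1 - a ^ k) := by rw [mul_pow]; ring
  rw [h1, mul_pow a b k]
  generalize b ^ k = B at *
  generalize a ^ k = A at *
  field_simp

/-! ### The Bergman kernel of the Hartogs triangle -/

theorem hartogs_denominators_ne_zero {k : ℕ} {z w : ℂ × ℂ}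
    (hz : z ∈ hartogsTriangle (k : ℝ)) (hw : w ∈ hartogsTriangle (k : ℝ)) :
    1 - conj z.2 * w.2 ≠ 0 ∧ conj z.2 * w.2 - (conj z.1 * w.1) ^ k ≠ 0 := by
  obtain ⟨hz1, hz2⟩ := mem_hartogsTriangle_natCast.1 hz
  obtain ⟨hw1, hw2⟩ := mem_hartogsTriangle_natCast.1 hw
  constructor
  · rw [mul_comm]; exact one_sub_mul_conj_ne_zero hw2 hz2
  · intro h
    have h' := congrArg norm (sub_eq_zero.1 h)
    simp only [norm_mul, norm_pow, RCLike.norm_conj, mul_pow] at h'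
    have := mul_lt_mul'' hz1 hw1 (by positivity) (by positivity)
    exact this.ne' h'

theorem conj_hartogsFormula (k : ℕ) (s t : ℂ) :
    conj (hartogsFormula k s t) = hartogsFormula k (conj s) (conj t) := by
  simp [hartogsFormula, hartogsP, hartogsQ, map_sum]

theorem differentiableOn_conj_hartogsKernel {k : ℕ} (hk : k ≠ 0) {z : ℂ × ℂ}
    (hz : z ∈ hartogsTriangle (k : ℝ)) :
    DifferentiableOn ℂ (fun w : ℂ × ℂ =>
      conj (hartogsFormula k (z.1 * conj w.1) (z.2 * conj w.2))) (hartogsTriangle (k : ℝ)) := by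
  simp only [conj_hartogsFormula, map_mul, Complex.conj_conj]
  unfold hartogsFormula hartogsP hartogsQ
  simp only [div_eq_mul_inv]
  refine DifferentiableOn.fun_mul ?_ (DifferentiableOn.fun_inv ?_ fun w hw => ?_)
  · fun_prop
  · fun_prop
  obtain ⟨h1, h2⟩ := hartogs_denominators_ne_zero hz hw
  have hpi : (Real.pi : ℂ) ≠ 0 := by exact_mod_cast Real.pi_ne_zero
  have hk0 : (k : ℂ) ≠ 0 := by exact_mod_cast hk
  exact mul_ne_zero (mul_ne_zero (mul_ne_zero hk0 (pow_ne_zero 2 hpi)) (pow_ne_zero 2 h1))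
    (pow_ne_zero 2 h2)

/-- The deck transformation `(u, v) ↦ (c⁻¹ u, c v)` of the covering of degree `k`, when `c` is a
`k`-th root of unity. -/
noncomputable def hartogsDeck (c : ℂ) (p : ℂ × ℂ) : ℂ × ℂ := (c⁻¹ * p.1, c * p.2)

theorem hartogsDeck_mem {c : ℂ} (hc : ‖c‖ = 1) {p : ℂ × ℂ} (hp : p ∈ discProdPunctured) :
    hartogsDeck c p ∈ discProdPunctured := by
  have hc0 : c ≠ 0 := by rintro rfl; simp at hc
  rw [mem_discProdPunctured] at hp ⊢
  simpa [hartogsDeck, hc, hc0] using hp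

/-- Bell's transformation formula: the pullback of the closed form to the covering space is the sum
of the kernels of `discProdPunctured` over the deck group. -/
theorem hartogsKernel_pullback {k : ℕ} (hk : k ≠ 0) {ζ : ℂ} (hζ : IsPrimitiveRoot ζ k)
    {p q : ℂ × ℂ} (hp : p ∈ discProdPunctured) (hq : q ∈ discProdPunctured) :
    hartogsFormula k ((hartogsCover k p).1 * conj (hartogsCover k q).1)
        ((hartogsCover k p).2 * conj (hartogsCover k q).2) * conj ((k : ℂ) * q.2 ^ k) =
      (k * Real.pi ^ 2 * p.2 ^ k)⁻¹ * ∑ j ∈ Finset.range k,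
        1 / ((1 - (hartogsDeck (ζ ^ j) p).1 * conj q.1) ^ 2 *
          (1 - (hartogsDeck (ζ ^ j) p).2 * conj q.2) ^ 2) := by
  obtain ⟨hp1, hp2, hp0⟩ := mem_discProdPunctured.1 hp
  obtain ⟨hq1, hq2, hq0⟩ := mem_discProdPunctured.1 hq
  have hpow : ∀ x y : ℂ, ‖x‖ < 1 → ‖y‖ < 1 → 1 - (x * conj y) ^ k ≠ 0 := by
    intro x y hx hy
    rw [mul_pow, ← map_pow]
    exact one_sub_mul_conj_ne_zero (by rw [norm_pow]; exact pow_lt_one₀ (norm_nonneg _) hx hk)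
      (by rw [norm_pow]; exact pow_lt_one₀ (norm_nonneg _) hy hk)
  have hq0' : conj q.2 ≠ 0 := by simpa using hq0
  have hb0 : p.2 * conj q.2 ≠ 0 := mul_ne_zero hp0 hq0'
  have key := hartogsFormula_eq_sum_deck hk hζ (hpow p.1 q.1 hp1 hq1) (hpow p.2 q.2 hp2 hq2) hb0
  have e1 : (hartogsCover k p).1 * conj (hartogsCover k q).1 =
      (p.1 * conj q.1) * (p.2 * conj q.2) := by
    simp only [hartogsCover, map_mul]; ring
  have e2 : (hartogsCover k p).2 * conj (hartogsCover k q).2 = (p.2 * conj q.2) ^ k := by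
    simp only [hartogsCover, map_pow, mul_pow]
  have hpi : (Real.pi : ℂ) ≠ 0 := by exact_mod_cast Real.pi_ne_zero
  have hk0 : (k : ℂ) ≠ 0 := by exact_mod_cast hk
  rw [e1, e2, key]
  simp only [hartogsDeck, mul_assoc]
  rw [map_mul, map_pow, map_natCast, mul_pow]
  generalize (∑ j ∈ Finset.range k, _ : ℂ) = S
  have h3 := pow_ne_zero k hq0'
  field_simp

theorem exists_hartogsCover_eq {k : ℕ} (hk : k ≠ 0) {z : ℂ × ℂ}
    (hz : z ∈ hartogsTriangle (k : ℝ)) : ∃ p ∈ discProdPunctured, hartogsCover k p = z := by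
  rw [← image_hartogsCover_sheet hk (one_pow k)] at hz
  obtain ⟨p, hp, rfl⟩ := hz
  exact ⟨p, hp.1, rfl⟩

theorem norm_root_pow {k : ℕ} (hk : k ≠ 0) {ζ : ℂ} (hζ : IsPrimitiveRoot ζ k) (j : ℕ) :
    ‖ζ ^ j‖ = 1 := by
  rw [norm_pow, hζ.norm'_eq_one hk, one_pow]

/-- The kernel is unbounded near the boundary point `0`, but its pullback, weighted by the Jacobian,
is bounded. -/
theorem hartogsKernel_mem_bergmanSpace {k : ℕ} (hk : k ≠ 0) {z : ℂ × ℂ}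
    (hz : z ∈ hartogsTriangle (k : ℝ)) :
    (fun w : ℂ × ℂ => conj (hartogsFormula k (z.1 * conj w.1) (z.2 * conj w.2))) ∈
      BergmanSpace (hartogsTriangle (k : ℝ)) := by
  have hd := differentiableOn_conj_hartogsKernel hk hz
  refine ⟨hd, (memLp_hartogsCover_iff hk hd.continuousOn).1 ?_⟩
  obtain ⟨p, hp, rfl⟩ := exists_hartogsCover_eq hk hz
  have hζ := Complex.isPrimitiveRoot_exp k hk
  set ζ := Complex.exp (2 * Real.pi * Complex.I / k)
  refine MemLp.of_bound (C := ‖((k : ℂ) * Real.pi ^ 2 * p.2 ^ k)⁻¹‖ * ∑ j ∈ Finset.range k,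
    ((1 - ‖(hartogsDeck (ζ ^ j) p).1‖) ^ 2)⁻¹ * ((1 - ‖(hartogsDeck (ζ ^ j) p).2‖) ^ 2)⁻¹) ?_ ?_
  · refine ContinuousOn.aestronglyMeasurable ?_ isOpen_discProdPunctured.measurableSet
    refine ContinuousOn.mul (by fun_prop) ?_
    exact hd.continuousOn.comp (continuous_hartogsCover k).continuousOn
      fun q hq => hartogsCover_mem hk hq
  · refine ae_restrict_of_forall_mem isOpen_discProdPunctured.measurableSet fun q hq => ?_
    have h1 : ∀ x y : ℂ, ‖x * conj y‖ = ‖y * conj x‖ := fun x y => by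
      rw [norm_mul, norm_mul, RCLike.norm_conj, RCLike.norm_conj, mul_comm]
    rw [h1, hartogsKernel_pullback hk hζ hp hq, norm_mul]
    refine mul_le_mul_of_nonneg_left ?_ (norm_nonneg _)
    refine (norm_sum_le _ _).trans (Finset.sum_le_sum fun j _ => ?_)
    rw [one_div]
    exact norm_inv_bidisc_kernel_le (hartogsDeck_mem (norm_root_pow hk hζ j) hp) hq

theorem hartogsKernel_reproducing {k : ℕ} (hk : k ≠ 0) {z : ℂ × ℂ}
    (hz : z ∈ hartogsTriangle (k : ℝ)) {f : ℂ × ℂ → ℂ}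
    (hf : f ∈ BergmanSpace (hartogsTriangle (k : ℝ))) :
    f z = ∫ w in hartogsTriangle (k : ℝ),
      hartogsFormula k (z.1 * conj w.1) (z.2 * conj w.2) * f w := by
  obtain ⟨hfd, hfL⟩ := hf
  have hm : MeasurableSet (hartogsTriangle (k : ℝ)) :=
    (isOpen_hartogsTriangle_natCast k).measurableSet
  have hFc : ContinuousOn (fun w : ℂ × ℂ => hartogsFormula k (z.1 * conj w.1) (z.2 * conj w.2))
      (hartogsTriangle (k : ℝ)) := by
    have := Complex.continuous_conj.comp_continuousOn
      (differentiableOn_conj_hartogsKernel hk hz).continuousOn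
    simpa [Function.comp_def] using this
  have hcv := setIntegral_hartogsCover hk
    ((hFc.mul hfd.continuousOn).aestronglyMeasurable hm)
  obtain ⟨p, hp, rfl⟩ := exists_hartogsCover_eq hk hz
  have hζ := Complex.isPrimitiveRoot_exp k hk
  set ζ := Complex.exp (2 * Real.pi * Complex.I / k)
  set G : ℂ × ℂ → ℂ := fun q => (k : ℂ) * q.2 ^ k * f (hartogsCover k q) with hG
  have hGd : DifferentiableOn ℂ G discProdPunctured :=
    DifferentiableOn.mul (by fun_prop) (hfd.comp
      (fun q _ => (hasFDerivAt_hartogsCover k q).differentiableAt.differentiableWithinAt)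
      fun q hq => hartogsCover_mem hk hq)
  have hGL : MemLp G 2 (volume.restrict discProdPunctured) :=
    (memLp_hartogsCover_iff hk hfd.continuousOn).2 hfL
  have hGi : IntegrableOn G discProdPunctured := integrable_of_memLp_two hGL
  have hpj : ∀ j : ℕ, hartogsDeck (ζ ^ j) p ∈ discProdPunctured := fun j =>
    hartogsDeck_mem (norm_root_pow hk hζ j) hp
  -- The weighted pullback of `f` is invariant under the deck group since `v ^ k` is.
  have hGj : ∀ j : ℕ, G (hartogsDeck (ζ ^ j) p) = k * p.2 ^ k * f (hartogsCover k p) := by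
    intro j
    have hc0 : ζ ^ j ≠ 0 := pow_ne_zero j (hζ.ne_zero hk)
    have hck : (ζ ^ j) ^ k = 1 := by rw [← pow_mul, mul_comm, pow_mul, hζ.pow_eq_one, one_pow]
    have : hartogsCover k (hartogsDeck (ζ ^ j) p) = hartogsCover k p := by
      simp only [hartogsCover, hartogsDeck, mul_pow _ p.2, hck, one_mul, Prod.mk.injEq, and_true]
      field_simp
    simp only [hG, this]
    simp only [hartogsDeck, mul_pow _ p.2, hck, one_mul]
  have hint : ∀ q ∈ discProdPunctured, ‖(k : ℂ) * q.2 ^ k‖ ^ 2 •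
      (hartogsFormula k ((hartogsCover k p).1 * conj (hartogsCover k q).1)
        ((hartogsCover k p).2 * conj (hartogsCover k q).2) * f (hartogsCover k q)) =
      (k * Real.pi ^ 2 * p.2 ^ k)⁻¹ * ∑ j ∈ Finset.range k,
        G q / ((1 - (hartogsDeck (ζ ^ j) p).1 * conj q.1) ^ 2 *
          (1 - (hartogsDeck (ζ ^ j) p).2 * conj q.2) ^ 2) := by
    intro q hq
    have h1 : ((‖(k : ℂ) * q.2 ^ k‖ ^ 2 : ℝ) : ℂ) =
        (k : ℂ) * q.2 ^ k * conj ((k : ℂ) * q.2 ^ k) := by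
      rw [Complex.mul_conj, Complex.normSq_eq_norm_sq]
    simp only [div_eq_mul_one_div (G q)]
    rw [← Finset.mul_sum, mul_left_comm, ← hartogsKernel_pullback hk hζ hp hq, Complex.real_smul,
      h1, hG]
    ring
  simp only [Pi.mul_apply] at hcv
  rw [setIntegral_congr_fun isOpen_discProdPunctured.measurableSet hint, integral_const_mul,
    integral_finsetSum _ fun j _ => integrableOn_bidisc_kernel hGi (hpj j)] at hcv
  simp only [bidisc_reproducing hGd hGL (hpj _), hGj, Finset.sum_const, Finset.card_range,
    nsmul_eq_mul] at hcv
  have hpi : (Real.pi : ℂ) ≠ 0 := by exact_mod_cast Real.pi_ne_zero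
  have hk0 : (k : ℂ) ≠ 0 := by exact_mod_cast hk
  have hp0 : p.2 ≠ 0 := (mem_discProdPunctured.1 hp).2.2
  refine mul_left_cancel₀ hk0 (Eq.trans ?_ hcv)
  field_simp

theorem isBergmanKernel_congr {E : Type*} [NormedAddCommGroup E] [NormedSpace ℂ E]
    [MeasureSpace E] {Ω : Set E} (hΩ : MeasurableSet Ω) {B B' : E → E → ℂ}
    (h : ∀ z ∈ Ω, ∀ w ∈ Ω, B z w = B' z w) (hB' : IsBergmanKernel Ω B') :
    IsBergmanKernel Ω B := by
  intro z hz
  obtain ⟨⟨hd, hL⟩, hr⟩ := hB' z hz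
  have heq : EqOn (fun w => conj (B z w)) (fun w => conj (B' z w)) Ω := fun w hw => by
    simp only [h z hz w hw]
  refine ⟨⟨hd.congr heq, (memLp_congr_ae ?_).2 hL⟩, fun f hf => (hr f hf).trans ?_⟩
  · exact ae_restrict_of_forall_mem hΩ heq
  · exact setIntegral_congr_fun hΩ fun w hw => by simp only [h z hz w hw]

theorem isBergmanKernel_unique {E : Type*} [NormedAddCommGroup E] [NormedSpace ℂ E]
    [MeasureSpace E] [OpensMeasurableSpace E] [(volume : Measure E).IsOpenPosMeasure] {Ω : Set E}
    (hΩ : IsOpen Ω) {B B' : E → E → ℂ} (hB : IsBergmanKernel Ω B) (hB' : IsBergmanKernel Ω B') :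
    ∀ z ∈ Ω, ∀ w ∈ Ω, B z w = B' z w := by
  intro z hz
  obtain ⟨⟨hd, hL⟩, hr⟩ := hB z hz
  obtain ⟨⟨hd', hL'⟩, hr'⟩ := hB' z hz
  set h : E → ℂ := fun w => conj (B z w) - conj (B' z w) with hh
  have hhL : MemLp h 2 (volume.restrict Ω) := hL.sub hL'
  have hhA : h ∈ BergmanSpace Ω := ⟨hd.sub hd', hhL⟩
  have hLc : MemLp (fun w => B z w) 2 (volume.restrict Ω) := by
    simpa [Function.comp_def, Pi.star_def] using hL.star
  have hLc' : MemLp (fun w => B' z w) 2 (volume.restrict Ω) := by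
    simpa [Function.comp_def, Pi.star_def] using hL'.star
  -- Both kernels reproduce `h z`, and `h` is the conjugate of their difference.
  have h0 : ∫ w in Ω, ‖h w‖ ^ 2 = 0 := by
    have h1 : ∫ w in Ω, (B z w * h w - B' z w * h w) = 0 := by
      have hi : Integrable (fun w => B z w * h w) (volume.restrict Ω) := hLc.integrable_mul hhL
      have hi' : Integrable (fun w => B' z w * h w) (volume.restrict Ω) := hLc'.integrable_mul hhL
      rw [integral_sub hi hi', ← hr h hhA, ← hr' h hhA, sub_self]
    have h2 : ∀ w, B z w * h w - B' z w * h w = ((‖h w‖ ^ 2 : ℝ) : ℂ) := by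
      intro w
      rw [← Complex.normSq_eq_norm_sq, Complex.normSq_eq_conj_mul_self, hh]
      simp only [map_sub, Complex.conj_conj]
      ring
    simp only [h2] at h1
    rw [integral_complex_ofReal] at h1
    exact_mod_cast h1
  rw [integral_eq_zero_iff_of_nonneg (fun w => by positivity)
    ((memLp_two_iff_integrable_sq_norm hhL.1).1 hhL)] at h0
  have h3 : h =ᵐ[volume.restrict Ω] fun _ => 0 := by
    filter_upwards [h0] with w hw
    simpa using hw
  have h4 := Measure.eqOn_open_of_ae_eq h3 hΩ hhA.1.continuousOn continuousOn_const
  intro w hw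
  have h5 := h4 hw
  simp only [hh, sub_eq_zero] at h5
  exact (starRingEnd ℂ).injective h5

theorem isBergmanKernel_hartogs {k : ℕ} (hk : k ≠ 0) :
    IsBergmanKernel (hartogsTriangle (k : ℝ)) fun z w =>
      hartogsFormula k (z.1 * starRingEnd ℂ w.1) (z.2 * starRingEnd ℂ w.2) := fun _ hz =>
  ⟨hartogsKernel_mem_bergmanSpace hk hz, fun _ hf => hartogsKernel_reproducing hk hz hf⟩

/-- For a positive integer `k`, a function `B` is the Bergman kernel of the fat Hartogs triangle
of exponent `k` if and only if it is given there by the closed form (so the Bergman kernel exists,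
is unique, and equals the closed form). -/
theorem theorem1p1 (k : ℕ) (hk : 0 < k) (B : ℂ × ℂ → ℂ × ℂ → ℂ) :
    IsBergmanKernel (hartogsTriangle (k : ℝ)) B ↔
      ∀ z ∈ hartogsTriangle (k : ℝ), ∀ w ∈ hartogsTriangle (k : ℝ),
        B z w =
          hartogsFormula k (z.1 * starRingEnd ℂ w.1) (z.2 * starRingEnd ℂ w.2) :=
  have hO := isOpen_hartogsTriangle_natCast k
  ⟨fun hB => isBergmanKernel_unique hO hB (isBergmanKernel_hartogs hk.ne'),
    fun h => isBergmanKernel_congr hO.measurableSet h (isBergmanKernel_hartogs hk.ne')⟩
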